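/- Let $c,h,d,n$ be non-negative integers, let $F\in\mathbb{R}^{d\times n}$ have full row rank (that is, $\operatorname{rank}F=d$) and let $Y\in\mathbb{R}^{c\times n}$ be arbitrary. For $W_2\in\mathbb{R}^{c\times h}$ and $W_1\in\mathbb{R}^{h\times d}$ consider the Frobenius-norm loss of the two-layer linear network $W_2W_1F$, $$L(W_2,W_1)=\tfrac12\,\|W_2W_1F-Y\|_F^2 .$$ Then: 1. $L$ has no spurious local minima: every local minimum point of $L$ on $\mathbb{R}^{c\times h}\times\mathbb{R}^{h\times d}$ is a global minimum point. 2. Every degenerate critical point of $L$, that is, every $(W_2,W_1)$ with $\nabla L(W_2,W_1)=0$ and $\operatorname{rank}(W_2W_1)<\min\{d,h,c\}$, is either a global minimum point of $L$ or a second-order saddle point, i.e. a critical point at which the Hessian of $L$ has a negative eigenvalue. -/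

import Mathlib

-- Mathlib has no global norm on matrices. The one chosen here only serves to differentiate functions
-- of matrices: in finite dimension derivatives do not depend on it. It induces the usual topology.
attribute [local instance] Matrix.normedAddCommGroup Matrix.normedSpace

namespace LinearNet

/-- The parameters `(W₂, W₁)` of a two-layer linear network with input (feature) dimension `d`,
bottleneck width `h` and output dimension `c`. -/
abbrev Params (c h d : ℕ) : Type :=
  Matrix (Fin c) (Fin h) ℝ × Matrix (Fin h) (Fin d) ℝ

/-- The squared Frobenius norm of a matrix. -/
def frobSq {m n : ℕ} (A : Matrix (Fin m) (Fin n) ℝ) : ℝ :=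
  ∑ i, ∑ j, A i j ^ 2

/-- The Frobenius-norm loss `L(W₂, W₁) = ½ ‖W₂ W₁ F - Y‖_F²`, where the `n` columns of `F` are the
feature vectors of the samples and the `n` columns of `Y` are the targets. -/
noncomputable def loss {c h d n : ℕ} (F : Matrix (Fin d) (Fin n) ℝ) (Y : Matrix (Fin c) (Fin n) ℝ)
    (θ : Params c h d) : ℝ :=
  1 / 2 * frobSq (θ.1 * θ.2 * F - Y)

/-- `x` is a global minimum point of `f`. -/
def IsGlobalMin {E : Type*} (f : E → ℝ) (x : E) : Prop :=
  ∀ y, f x ≤ f y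

/-- `x` is a critical point of `f`: the derivative exists there and is zero. -/
def IsCriticalPoint {E : Type*} [NormedAddCommGroup E] [NormedSpace ℝ E] (f : E → ℝ) (x : E) :
    Prop :=
  HasFDerivAt f (0 : E →L[ℝ] ℝ) x

/-- `x` is a second-order saddle point of `f`: a critical point at which the Hessian has a direction
of strictly negative curvature (equivalently, in finite dimension, a negative eigenvalue). -/
def IsSecondOrderSaddle {E : Type*} [NormedAddCommGroup E] [NormedSpace ℝ E] (f : E → ℝ) (x : E) :
    Prop :=
  IsCriticalPoint f x ∧ ∃ v : E, fderiv ℝ (fderiv ℝ f) x v v < 0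

/-- `θ = (W₂, W₁)` is degenerate: the rank of `W₂ W₁` is less than the largest rank that the layer
widths allow. -/
def IsDegenerate {c h d : ℕ} (θ : Params c h d) : Prop :=
  (θ.1 * θ.2).rank < min d (min h c)

end LinearNet

/-!
Only the product `W₂ W₁` enters the loss, and the loss is convex in that product. Write
`G = (W₂ W₁ F - Y) Fᵀ` for the gradient with respect to the product (`productGrad`). If `G = 0`,
convexity gives a global minimum (`isGlobalMin_of_productGrad_eq_zero`). Along a line through
`(W₂, W₁)` with direction `(A, B)` the loss is a quartic polynomial (`loss_add_smul`), and the
Hessian is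
`‖(W₂ B + A W₁) F‖² + 2 ⟨A B, G⟩` (`secondVar`).

*Degenerate critical points.* If `rank (W₂ W₁) < h`, then some `u ≠ 0` satisfies `W₂ u = 0` or
`uᵀ W₁ = 0` (`exists_ker_of_rank_lt`). Say `W₂ u = 0`. Then `B = s u bᵀ` does not contribute to
the square, while `⟨A B, G⟩` is linear in `s` and, if `G ≠ 0`, nonzero for suitable `A` and `b`.
Hence either `G = 0` or the Hessian takes negative values (`exists_secondVar_neg`).

*Local minima.* The same argument settles the case where `W₂` is not injective, so let it be
injective. As `F Fᵀ` is invertible, `Y` may be replaced by its projection `Z = W₀ F` to the row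
space of `F`, and criticality says that in `Z = K + R`, with `K = W₂ W₁ F` and `R = Z - K`, the two
summands have orthogonal column spaces and orthogonal row spaces. Testing the Hessian with a
suitable pair of rank-one matrices gives
`‖x‖² ‖Rᵀ y‖² ≤ ‖y‖² ‖Kᵀ x‖²` for all `x` in the range of `W₂` and all `y`
(`dotProduct_le_of_secondVar_nonneg`), so one scalar `s` separates the squared singular values of
`R` from those of `K` (`exists_separating_scalar`). Therefore `K` carries the `h` largest singular
values of `Z`, and by an Eckart–Young argument with traces of projections it is a best
approximation of `Z` of rank at most `h` (`frobSq_le_of_separated`).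
-/

section

open Matrix Filter Topology

namespace LinearNet

/-! ### The squared Frobenius norm -/

lemma frobSq_eq_trace {m n : ℕ} (A : Matrix (Fin m) (Fin n) ℝ) :
    frobSq A = (Aᵀ * A).trace := by
  simp only [frobSq, trace, diag_apply, mul_apply, transpose_apply, ← sq]
  exact Finset.sum_comm

lemma frobSq_nonneg {m n : ℕ} (A : Matrix (Fin m) (Fin n) ℝ) : 0 ≤ frobSq A :=
  Finset.sum_nonneg fun _ _ => Finset.sum_nonneg fun _ _ => sq_nonneg _

lemma frobSq_eq_zero {m n : ℕ} {A : Matrix (Fin m) (Fin n) ℝ} (h : frobSq A = 0) : A = 0 := by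
  rw [frobSq_eq_trace] at h
  exact trace_conjTranspose_mul_self_eq_zero_iff.1
    (by simpa [conjTranspose_eq_transpose_of_trivial] using h)

lemma frobSq_transpose {m n : ℕ} (A : Matrix (Fin m) (Fin n) ℝ) : frobSq Aᵀ = frobSq A :=
  Finset.sum_comm

lemma frobSq_neg {m n : ℕ} (A : Matrix (Fin m) (Fin n) ℝ) : frobSq (-A) = frobSq A := by
  simp [frobSq]

lemma frobSq_smul {m n : ℕ} (t : ℝ) (A : Matrix (Fin m) (Fin n) ℝ) :
    frobSq (t • A) = t ^ 2 * frobSq A := by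
  simp [frobSq, mul_pow, Finset.mul_sum]

lemma frobSq_add {m n : ℕ} (A B : Matrix (Fin m) (Fin n) ℝ) :
    frobSq (A + B) = frobSq A + 2 * (Aᵀ * B).trace + frobSq B := by
  have h : (Bᵀ * A).trace = (Aᵀ * B).trace := by
    rw [← trace_transpose, transpose_mul, transpose_transpose]
  simp only [frobSq_eq_trace, transpose_add, Matrix.add_mul, Matrix.mul_add, trace_add, h]
  ring

lemma frobSq_eq_sum_col {m n : ℕ} (A : Matrix (Fin m) (Fin n) ℝ) :
    frobSq A = ∑ j, A.col j ⬝ᵥ A.col j := by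
  simp only [frobSq, dotProduct, col_apply, ← sq]
  exact Finset.sum_comm

lemma frobSq_vecMulVec {m n : ℕ} (a : Fin m → ℝ) (b : Fin n → ℝ) :
    frobSq (vecMulVec a b) = (a ⬝ᵥ a) * (b ⬝ᵥ b) := by
  simp only [frobSq, vecMulVec_apply, dotProduct, Finset.sum_mul_sum]
  exact Finset.sum_congr rfl fun _ _ => Finset.sum_congr rfl fun _ _ => by ring

lemma trace_transpose_vecMulVec_mul {m n : ℕ} (a : Fin m → ℝ) (b : Fin n → ℝ)
    (G : Matrix (Fin m) (Fin n) ℝ) :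
    ((vecMulVec a b)ᵀ * G).trace = a ⬝ᵥ G *ᵥ b := by
  rw [transpose_vecMulVec, vecMulVec_mul, trace_vecMulVec, dotProduct_comm, dotProduct_mulVec]

/-! ### The loss along a line -/

/-- The gradient `(W₂ W₁ F - Y) Fᵀ` of `W ↦ ½ ‖W F - Y‖²` at the product `W = W₂ W₁`. -/
def productGrad {c h d n : ℕ} (F : Matrix (Fin d) (Fin n) ℝ) (Y : Matrix (Fin c) (Fin n) ℝ)
    (θ : Params c h d) : Matrix (Fin c) (Fin d) ℝ :=
  (θ.1 * θ.2 * F - Y) * Fᵀ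

/-- The first-order variation `W₂ B + A W₁` of the product `W₂ W₁` in the direction `(A, B)`. -/
def productVar {c h d : ℕ} (θ v : Params c h d) : Matrix (Fin c) (Fin d) ℝ :=
  θ.1 * v.2 + v.1 * θ.2

/-- The Hessian quadratic form `‖(W₂ B + A W₁) F‖² + 2 ⟨A B, G⟩` of the loss at `θ = (W₂, W₁)` in
the direction `v = (A, B)`, where `G` is `productGrad F Y θ`. -/
def secondVar {c h d n : ℕ} (F : Matrix (Fin d) (Fin n) ℝ) (Y : Matrix (Fin c) (Fin n) ℝ)
    (θ v : Params c h d) : ℝ :=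
  frobSq (productVar θ v * F) + 2 * ((v.1 * v.2)ᵀ * productGrad F Y θ).trace

lemma trace_transpose_mul_productGrad {c h d n : ℕ} (F : Matrix (Fin d) (Fin n) ℝ)
    (Y : Matrix (Fin c) (Fin n) ℝ) (θ : Params c h d) (C : Matrix (Fin c) (Fin d) ℝ) :
    ((θ.1 * θ.2 * F - Y)ᵀ * (C * F)).trace = (Cᵀ * productGrad F Y θ).trace := by
  rw [productGrad, ← trace_transpose]
  simp only [transpose_mul, transpose_transpose]
  rw [Matrix.mul_assoc, trace_mul_comm, Matrix.mul_assoc]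

lemma loss_add_smul {c h d n : ℕ} (F : Matrix (Fin d) (Fin n) ℝ) (Y : Matrix (Fin c) (Fin n) ℝ)
    (θ v : Params c h d) (t : ℝ) :
    loss F Y (θ + t • v) = loss F Y θ + ((productVar θ v)ᵀ * productGrad F Y θ).trace * t
      + secondVar F Y θ v / 2 * t ^ 2
      + ((productVar θ v * F)ᵀ * (v.1 * v.2 * F)).trace * t ^ 3
      + frobSq (v.1 * v.2 * F) / 2 * t ^ 4 := by
  have key : (θ + t • v).1 * (θ + t • v).2 * F - Y
      = (θ.1 * θ.2 * F - Y) + (t • (productVar θ v * F) + (t ^ 2) • (v.1 * v.2 * F)) := by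
    simp only [productVar, Prod.fst_add, Prod.snd_add, Prod.smul_fst, Prod.smul_snd, Matrix.add_mul,
      Matrix.mul_add, Matrix.smul_mul, Matrix.mul_smul, smul_smul, smul_add, sq]
    abel
  rw [loss, key, frobSq_add, frobSq_add, Matrix.mul_add, trace_add]
  simp only [frobSq_smul, Matrix.mul_smul, Matrix.smul_mul, transpose_smul, trace_smul, smul_eq_mul,
    trace_transpose_mul_productGrad, secondVar, loss]
  ring

lemma contDiff_loss {c h d n : ℕ} (F : Matrix (Fin d) (Fin n) ℝ) (Y : Matrix (Fin c) (Fin n) ℝ) :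
    ContDiff ℝ 2 (loss (h := h) F Y) := by
  have h1 : ∀ i j, ContDiff ℝ 2 fun θ : Params c h d => θ.1 i j := fun i j =>
    (contDiff_apply_apply ℝ ℝ i j).comp contDiff_fst
  have h2 : ∀ i j, ContDiff ℝ 2 fun θ : Params c h d => θ.2 i j := fun i j =>
    (contDiff_apply_apply ℝ ℝ i j).comp contDiff_snd
  unfold loss frobSq
  simp only [Matrix.sub_apply, Matrix.mul_apply]
  exact contDiff_const.mul <| ContDiff.sum fun i _ => ContDiff.sum fun j _ =>
    ((ContDiff.sum fun k _ => (ContDiff.sum fun l _ => (h1 i l).mul (h2 l k)).mul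
      contDiff_const).sub contDiff_const).pow 2

/-! ### Derivatives of functions that are quartic along a line -/

section Line
variable {E : Type*} [NormedAddCommGroup E] [NormedSpace ℝ E]

lemma fderiv_of_quartic {f : E → ℝ} {x v : E} (hf : ContDiff ℝ 2 f) {a₀ a₁ a₂ a₃ a₄ : ℝ}
    (h : ∀ t : ℝ, f (x + t • v) = a₀ + a₁ * t + a₂ * t ^ 2 + a₃ * t ^ 3 + a₄ * t ^ 4) :
    fderiv ℝ f x v = a₁ ∧ fderiv ℝ (fderiv ℝ f) x v v = 2 * a₂ := by
  have hline : ∀ t : ℝ, HasDerivAt (fun t : ℝ => x + t • v) v t := fun t => by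
    simpa using ((hasDerivAt_id t).smul_const v).const_add x
  have hfd : Differentiable ℝ f := hf.differentiable (by norm_num)
  have hf'd : Differentiable ℝ (fderiv ℝ f) :=
    (hf.fderiv_right (m := 1) (by norm_num)).differentiable (by norm_num)
  have h1 : ∀ t : ℝ, fderiv ℝ f (x + t • v) v
      = a₁ + 2 * a₂ * t + 3 * a₃ * t ^ 2 + 4 * a₄ * t ^ 3 := fun t => by
    have e1 : HasDerivAt (fun t : ℝ => f (x + t • v)) (fderiv ℝ f (x + t • v) v) t :=
      (hfd _).hasFDerivAt.comp_hasDerivAt t (hline t)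
    simp only [h] at e1
    have e2 := (((((hasDerivAt_id t).const_mul a₁).const_add a₀).add
      (((hasDerivAt_id t).pow 2).const_mul a₂)).add
      (((hasDerivAt_id t).pow 3).const_mul a₃)).add (((hasDerivAt_id t).pow 4).const_mul a₄)
    refine (e1.unique e2).trans ?_
    simp
    ring
  refine ⟨by simpa using h1 0, ?_⟩
  have e1 : HasDerivAt (fun t : ℝ => fderiv ℝ f (x + t • v) v)
      (fderiv ℝ (fderiv ℝ f) (x + (0 : ℝ) • v) v v) 0 :=
    (ContinuousLinearMap.apply ℝ ℝ v).hasFDerivAt.comp_hasDerivAt (0 : ℝ)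
      ((hf'd _).hasFDerivAt.comp_hasDerivAt (0 : ℝ) (hline 0))
  simp only [h1] at e1
  have e2 := ((((hasDerivAt_id (0 : ℝ)).const_mul (2 * a₂)).const_add a₁).add
      (((hasDerivAt_id (0 : ℝ)).pow 2).const_mul (3 * a₃))).add
      (((hasDerivAt_id (0 : ℝ)).pow 3).const_mul (4 * a₄))
  simpa [id_def] using e1.unique e2

lemma IsCriticalPoint.linear_coeff_eq_zero {f : E → ℝ} {x v : E} (hcrit : IsCriticalPoint f x)
    (hf : ContDiff ℝ 2 f) {a₀ a₁ a₂ a₃ a₄ : ℝ}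
    (h : ∀ t : ℝ, f (x + t • v) = a₀ + a₁ * t + a₂ * t ^ 2 + a₃ * t ^ 3 + a₄ * t ^ 4) :
    a₁ = 0 := by
  rw [← (fderiv_of_quartic hf h).1, HasFDerivAt.fderiv hcrit, _root_.zero_apply]

lemma IsCriticalPoint.isSecondOrderSaddle {f : E → ℝ} {x v : E} (hcrit : IsCriticalPoint f x)
    (hf : ContDiff ℝ 2 f) {a₀ a₁ a₂ a₃ a₄ : ℝ}
    (h : ∀ t : ℝ, f (x + t • v) = a₀ + a₁ * t + a₂ * t ^ 2 + a₃ * t ^ 3 + a₄ * t ^ 4)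
    (ha₂ : a₂ < 0) : IsSecondOrderSaddle f x :=
  ⟨hcrit, v, by rw [(fderiv_of_quartic hf h).2]; linarith⟩

lemma isCriticalPoint_of_isLocalMin {f : E → ℝ} {x : E} (hf : ContDiff ℝ 2 f)
    (hmin : IsLocalMin f x) : IsCriticalPoint f x := by
  have h := (hf.differentiable (by norm_num) x).hasFDerivAt
  rwa [hmin.fderiv_eq_zero] at h

lemma nonneg_of_isLocalMin_quartic {f : E → ℝ} {x v : E} (hmin : IsLocalMin f x)
    {a₂ a₃ a₄ : ℝ}
    (h : ∀ t : ℝ, f (x + t • v) = f x + a₂ * t ^ 2 + a₃ * t ^ 3 + a₄ * t ^ 4) :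
    0 ≤ a₂ := by
  have hc : Tendsto (fun t : ℝ => x + t • v) (𝓝 0) (𝓝 x) := by
    have : Continuous fun t : ℝ => x + t • v := by fun_prop
    simpa using this.tendsto 0
  -- Divide by `t ^ 2` and let `t` tend to `0`.
  have hev : ∀ᶠ t in 𝓝[≠] (0 : ℝ), 0 ≤ a₂ + a₃ * t + a₄ * t ^ 2 := by
    filter_upwards [(hc.eventually hmin).filter_mono nhdsWithin_le_nhds,
      self_mem_nhdsWithin] with t ht ht0
    rw [h t] at ht
    have : 0 < t ^ 2 := by have : t ≠ 0 := ht0; positivity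
    refine nonneg_of_mul_nonneg_right (a := t ^ 2) ?_ this
    linarith
  have hlim : Tendsto (fun t : ℝ => a₂ + a₃ * t + a₄ * t ^ 2) (𝓝[≠] 0) (𝓝 a₂) := by
    have : Continuous fun t : ℝ => a₂ + a₃ * t + a₄ * t ^ 2 := by fun_prop
    simpa using (this.tendsto 0).mono_left nhdsWithin_le_nhds
  exact ge_of_tendsto hlim hev

end Line

/-! ### Orthogonal projections as matrices -/

/-- Gram–Schmidt: finitely many vectors are fixed by an orthogonal projection whose trace, that is
whose rank, is at most their number. -/
lemma exists_orthogonal_projection_finset {c : ℕ} {ι : Type*} (v : ι → Fin c → ℝ) (s : Finset ι) :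
    ∃ P : Matrix (Fin c) (Fin c) ℝ, Pᵀ = P ∧ P * P = P ∧ P.trace ≤ s.card ∧
      ∀ i ∈ s, P *ᵥ v i = v i := by
  classical
  induction s using Finset.induction_on with
  | empty => exact ⟨0, by simp⟩
  | insert a s ha ih =>
    obtain ⟨P, hPt, hPP, htr, hP⟩ := ih
    -- The component of the new vector orthogonal to the range of `P`.
    set w := v a - P *ᵥ v a with hw
    have hPw : P *ᵥ w = 0 := by rw [hw, mulVec_sub, mulVec_mulVec, hPP, sub_self]
    have hwP : w ᵥ* P = 0 := by rw [← hPt, vecMul_transpose, hPw]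
    rw [Finset.card_insert_of_notMem ha, Nat.cast_add, Nat.cast_one]
    rcases eq_or_ne w 0 with hw0 | hw0
    · refine ⟨P, hPt, hPP, by linarith, fun i hi => ?_⟩
      rcases Finset.mem_insert.1 hi with rfl | hi
      · exact (sub_eq_zero.1 (hw.symm.trans hw0)).symm
      · exact hP i hi
    · have hww : w ⬝ᵥ w ≠ 0 := fun h => hw0 (dotProduct_self_eq_zero.1 h)
      refine ⟨P + (w ⬝ᵥ w)⁻¹ • vecMulVec w w, ?_, ?_, ?_, fun i hi => ?_⟩
      · rw [transpose_add, transpose_smul, transpose_vecMulVec, hPt]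
      · have hPw' : P * vecMulVec w w = 0 := by rw [mul_vecMulVec, hPw, zero_vecMulVec]
        have hwP' : vecMulVec w w * P = 0 := by rw [vecMulVec_mul, hwP, vecMulVec_zero]
        have hsq : vecMulVec w w * vecMulVec w w = (w ⬝ᵥ w) • vecMulVec w w := by
          rw [vecMulVec_mul_vecMulVec, vecMulVec_smul]
        rw [Matrix.add_mul, Matrix.mul_add, Matrix.mul_add, hPP, Matrix.mul_smul, hPw',
          Matrix.smul_mul, hwP', Matrix.smul_mul, Matrix.mul_smul, hsq, inv_smul_smul₀ hww,
          smul_zero, add_zero, zero_add]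
      · rw [trace_add, trace_smul, trace_vecMulVec, smul_eq_mul, inv_mul_cancel₀ hww]
        linarith
      · have hdot : ∀ x, P *ᵥ x = x → w ⬝ᵥ x = 0 := fun x hx => by
          rw [← hx, dotProduct_mulVec, hwP, zero_dotProduct]
        simp only [add_mulVec, smul_mulVec, vecMulVec_mulVec]
        rcases Finset.mem_insert.1 hi with rfl | hi
        · have h1 : w ⬝ᵥ v i = w ⬝ᵥ w := by
            conv_rhs => rw [hw, dotProduct_sub, ← hw, dotProduct_mulVec, hwP, zero_dotProduct,
              sub_zero]
          rw [h1, op_smul_eq_smul, inv_smul_smul₀ hww, hw, add_sub_cancel]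
        · rw [hdot _ (hP i hi), hP i hi]
          simp

lemma exists_orthogonal_projection {c h : ℕ} (V : Matrix (Fin c) (Fin h) ℝ) :
    ∃ P : Matrix (Fin c) (Fin c) ℝ, Pᵀ = P ∧ P * P = P ∧ P.trace ≤ h ∧ P * V = V := by
  obtain ⟨P, hPt, hPP, htr, hP⟩ := exists_orthogonal_projection_finset V.col Finset.univ
  refine ⟨P, hPt, hPP, by simpa using htr, ?_⟩
  ext i j
  exact congrFun (hP j (Finset.mem_univ j)) i

/-- An injective matrix `V` has the left inverse `C = (Vᵀ V)⁻¹ Vᵀ`, for which `V C` is the orthogonal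
projection onto the range of `V`. -/
lemma exists_left_inverse {c h : ℕ} (V : Matrix (Fin c) (Fin h) ℝ)
    (hV : ∀ x, V *ᵥ x = 0 → x = 0) :
    ∃ C : Matrix (Fin h) (Fin c) ℝ, C * V = 1 ∧ (V * C)ᵀ = V * C := by
  have hu : IsUnit (Vᵀ * V) := by
    rw [← mulVec_injective_iff_isUnit]
    refine (injective_iff_map_eq_zero (Vᵀ * V).mulVecLin).2 fun x hx => hV x ?_
    have hx' : (Vᵀ * V) *ᵥ x = 0 := hx
    refine dotProduct_self_eq_zero.1 ?_
    rw [dotProduct_mulVec, ← mulVec_transpose, mulVec_mulVec, hx', zero_dotProduct]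
  refine ⟨(Vᵀ * V)⁻¹ * Vᵀ, ?_, ?_⟩
  · rw [Matrix.mul_assoc, nonsing_inv_mul _ ((isUnit_iff_isUnit_det _).1 hu)]
  · simp [transpose_mul, transpose_nonsing_inv, Matrix.mul_assoc]

lemma frobSq_mul_projection {m c : ℕ} (A : Matrix (Fin m) (Fin c) ℝ)
    {P : Matrix (Fin c) (Fin c) ℝ} (hPt : Pᵀ = P) (hPP : P * P = P) :
    frobSq (A * P) = (P * (Aᵀ * A)).trace := by
  rw [frobSq_eq_trace, transpose_mul, hPt, ← Matrix.mul_assoc, trace_mul_comm, Matrix.mul_assoc,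
    ← Matrix.mul_assoc, hPP]

/-! ### Best approximation of bounded rank -/

lemma frobSq_mul_le {m c k : ℕ} {s : ℝ} {B : Matrix (Fin m) (Fin c) ℝ}
    (hB : ∀ y, (B *ᵥ y) ⬝ᵥ (B *ᵥ y) ≤ s * (y ⬝ᵥ y)) (A : Matrix (Fin c) (Fin k) ℝ) :
    frobSq (B * A) ≤ s * frobSq A := by
  simp only [frobSq_eq_sum_col, Finset.mul_sum]
  exact Finset.sum_le_sum fun j _ => hB (A.col j)

lemma le_frobSq_mul {m c h k : ℕ} {s : ℝ} {B : Matrix (Fin m) (Fin c) ℝ}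
    {V : Matrix (Fin c) (Fin h) ℝ}
    (hB : ∀ x, s * (V *ᵥ x ⬝ᵥ V *ᵥ x) ≤ (B *ᵥ (V *ᵥ x)) ⬝ᵥ (B *ᵥ (V *ᵥ x)))
    (A : Matrix (Fin h) (Fin k) ℝ) :
    s * frobSq (V * A) ≤ frobSq (B * (V * A)) := by
  simp only [frobSq_eq_sum_col, Finset.mul_sum]
  exact Finset.sum_le_sum fun j _ => hB (A.col j)

/-- An Eckart–Young inequality. Let `Z = V N + R`, where the two summands have orthogonal column
spaces and orthogonal row spaces. If `s` is at least all squared singular values of `R` and at most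
those of `V N` on the `h`-dimensional range of `V`, then no matrix `V' N'` of rank at most `h` is
closer to `Z` than `V N`. -/
lemma frobSq_le_of_separated {c h n : ℕ} {V : Matrix (Fin c) (Fin h) ℝ}
    (hV : ∀ x, V *ᵥ x = 0 → x = 0) {N : Matrix (Fin h) (Fin n) ℝ} {R : Matrix (Fin c) (Fin n) ℝ}
    (hVR : Vᵀ * R = 0) (hRN : R * Nᵀ = 0) {s : ℝ} (hs : 0 ≤ s)
    (hle : ∀ y, (Rᵀ *ᵥ y) ⬝ᵥ (Rᵀ *ᵥ y) ≤ s * (y ⬝ᵥ y))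
    (hge : ∀ x, s * (V *ᵥ x ⬝ᵥ V *ᵥ x) ≤ ((V * N)ᵀ *ᵥ (V *ᵥ x)) ⬝ᵥ ((V * N)ᵀ *ᵥ (V *ᵥ x)))
    (V' : Matrix (Fin c) (Fin h) ℝ) (N' : Matrix (Fin h) (Fin n) ℝ) :
    frobSq R ≤ frobSq (V' * N' - (V * N + R)) := by
  obtain ⟨C, hCV, hPt⟩ := exists_left_inverse V hV
  obtain ⟨Q, hQt, hQQ, hQtr, hQV⟩ := exists_orthogonal_projection V'
  set P := V * C with hP
  have hPV : P * V = V := by rw [hP, Matrix.mul_assoc, hCV, Matrix.mul_one]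
  have hPtr : P.trace = h := by rw [hP, trace_mul_comm, hCV, trace_one, Fintype.card_fin]
  have hPP : P * P = P := by
    conv_lhs => rw [hP, ← Matrix.mul_assoc, ← hP, hPV]
  have hRV : Rᵀ * V = 0 := by rw [← transpose_eq_zero, transpose_mul, transpose_transpose, hVR]
  have hRP : Rᵀ * P = 0 := by rw [hP, ← Matrix.mul_assoc, hRV, Matrix.zero_mul]
  have hQ't : (1 - Q)ᵀ = 1 - Q := by rw [transpose_sub, transpose_one, hQt]
  have hQ'Q' : (1 - Q) * (1 - Q) = 1 - Q := by
    simp [Matrix.sub_mul, Matrix.mul_sub, hQQ]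
  have hP't : (1 - P)ᵀ = 1 - P := by rw [transpose_sub, transpose_one, hPt]
  have hP'P' : (1 - P) * (1 - P) = 1 - P := by
    simp [Matrix.sub_mul, Matrix.mul_sub, hPP]
  -- Compressing to the orthogonal complement of `range V'` kills `V' * N'`.
  have h1 : frobSq ((V * N + R)ᵀ * (1 - Q)) ≤ frobSq (V' * N' - (V * N + R)) := by
    have e : frobSq ((V * N + R)ᵀ * (1 - Q)) = frobSq ((V' * N' - (V * N + R))ᵀ * (1 - Q)) := by
      rw [← frobSq_neg, ← frobSq_transpose, ← frobSq_transpose (_ * (1 - Q))]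
      congr 1
      simp only [transpose_neg, transpose_mul _ (1 - Q), hQ't, transpose_transpose]
      rw [Matrix.mul_sub _ (V' * N'), ← Matrix.mul_assoc, Matrix.sub_mul 1 Q V', hQV]
      simp
    rw [e, ← frobSq_transpose (V' * N' - _)]
    set D := (V' * N' - (V * N + R))ᵀ
    have : frobSq D = frobSq (D * (1 - Q)) + frobSq (D * Q) := by
      rw [frobSq_mul_projection D hQ't hQ'Q', frobSq_mul_projection D hQt hQQ, ← trace_add,
        ← Matrix.add_mul, sub_add_cancel, Matrix.one_mul, frobSq_eq_trace]
    linarith [frobSq_nonneg (D * Q)]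
  -- The cross terms vanish because the two summands have orthogonal row spaces.
  have h2 : frobSq ((V * N + R)ᵀ * (1 - Q))
      = frobSq ((V * N)ᵀ * (1 - Q)) + (frobSq R - frobSq (Rᵀ * Q)) := by
    have hR : frobSq R = (Rᵀᵀ * Rᵀ).trace := by rw [← frobSq_transpose, frobSq_eq_trace]
    have hNR : N * Rᵀ = 0 := by rw [← transpose_eq_zero, transpose_mul, transpose_transpose, hRN]
    have e : (V * N + R) * (V * N + R)ᵀ = (V * N) * (V * N)ᵀ + R * Rᵀ := by
      rw [transpose_add, transpose_mul, Matrix.add_mul, Matrix.mul_add, Matrix.mul_add,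
        ← Matrix.mul_assoc R, hRN, Matrix.mul_assoc V N Rᵀ, hNR]
      simp
    rw [hR]
    simp only [frobSq_mul_projection _ hQ't hQ'Q', frobSq_mul_projection _ hQt hQQ,
      transpose_transpose, e, Matrix.mul_add, Matrix.sub_mul, trace_add, trace_sub, Matrix.one_mul]
  have h3 : s * frobSq (P * (1 - Q)) ≤ frobSq ((V * N)ᵀ * (1 - Q)) := by
    have := le_frobSq_mul hge (C * (1 - Q))
    have hVN : (V * N)ᵀ * P = (V * N)ᵀ := by
      conv_lhs => rw [← hPt, ← transpose_mul, ← Matrix.mul_assoc, hPV]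
    rwa [← Matrix.mul_assoc, ← hP, ← Matrix.mul_assoc, hVN] at this
  have h4 : frobSq (Rᵀ * Q) ≤ s * frobSq ((1 - P) * Q) := by
    have := frobSq_mul_le hle ((1 - P) * Q)
    rwa [← Matrix.mul_assoc, Matrix.mul_sub, hRP, Matrix.mul_one, sub_zero] at this
  -- The difference of the two sides is `tr P - tr Q`, and `tr Q ≤ h = tr P`.
  have h5 : frobSq ((1 - P) * Q) ≤ frobSq (P * (1 - Q)) := by
    rw [frobSq_mul_projection _ hQ't hQ'Q', frobSq_mul_projection _ hQt hQQ, hP't, hP'P', hPt, hPP]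
    simp only [Matrix.sub_mul, Matrix.mul_sub, Matrix.one_mul, Matrix.mul_one, trace_sub, hPtr]
    linarith
  linarith [mul_le_mul_of_nonneg_left h5 hs]

/-- The Rayleigh quotients of `R Rᵀ` are separated by one scalar from those of `K Kᵀ` on the range
of `V`. -/
lemma exists_separating_scalar {c h n : ℕ} [Nonempty (Fin h)] {V : Matrix (Fin c) (Fin h) ℝ}
    (hV : ∀ x, V *ᵥ x = 0 → x = 0) {K R : Matrix (Fin c) (Fin n) ℝ}
    (hray : ∀ x y, (V *ᵥ x ⬝ᵥ V *ᵥ x) * (Rᵀ *ᵥ y ⬝ᵥ Rᵀ *ᵥ y)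
      ≤ (y ⬝ᵥ y) * (Kᵀ *ᵥ (V *ᵥ x) ⬝ᵥ Kᵀ *ᵥ (V *ᵥ x))) :
    ∃ s : ℝ, 0 ≤ s ∧ (∀ y, Rᵀ *ᵥ y ⬝ᵥ Rᵀ *ᵥ y ≤ s * (y ⬝ᵥ y)) ∧
      ∀ x, s * (V *ᵥ x ⬝ᵥ V *ᵥ x) ≤ Kᵀ *ᵥ (V *ᵥ x) ⬝ᵥ Kᵀ *ᵥ (V *ᵥ x) := by
  set S : Set ℝ := {t | ∃ y, y ≠ 0 ∧ t = (Rᵀ *ᵥ y ⬝ᵥ Rᵀ *ᵥ y) / (y ⬝ᵥ y)}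
  set T : Set ℝ := {t | ∃ x, x ≠ 0 ∧ t =
    (Kᵀ *ᵥ (V *ᵥ x) ⬝ᵥ Kᵀ *ᵥ (V *ᵥ x)) / (V *ᵥ x ⬝ᵥ V *ᵥ x)}
  have hpos : ∀ {m : ℕ} {y : Fin m → ℝ}, y ≠ 0 → 0 < y ⬝ᵥ y := fun hy =>
    lt_of_le_of_ne (dotProduct_self_star_nonneg _) fun h0 => hy (dotProduct_self_eq_zero.1 h0.symm)
  have hxV : ∀ {x}, x ≠ 0 → V *ᵥ x ≠ 0 := fun hx h0 => hx (hV _ h0)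
  obtain ⟨b, hb⟩ : ∃ b : Fin h → ℝ, b ≠ 0 := exists_ne 0
  obtain ⟨s, hS, hT⟩ := exists_between_of_forall_le (s := S) (t := T)
    ⟨_, V *ᵥ b, hxV hb, rfl⟩ ⟨_, b, hb, rfl⟩ (by
      rintro _ ⟨y, hy, rfl⟩ _ ⟨x, hx, rfl⟩
      rw [div_le_div_iff₀ (hpos hy) (hpos (hxV hx))]
      linarith [hray x y])
  refine ⟨s, (div_nonneg (dotProduct_self_star_nonneg _) (dotProduct_self_star_nonneg _)).trans
    (hS ⟨V *ᵥ b, hxV hb, rfl⟩), fun y => ?_, fun x => ?_⟩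
  · rcases eq_or_ne y 0 with rfl | hy
    · simp
    · exact (div_le_iff₀ (hpos hy)).1 (hS ⟨y, hy, rfl⟩)
  · rcases eq_or_ne x 0 with rfl | hx
    · simp
    · exact (le_div_iff₀ (hpos (hxV hx))).1 (hT ⟨x, hx, rfl⟩)

/-! ### First- and second-order conditions for the loss -/

section Net
variable {c h d n : ℕ} {F : Matrix (Fin d) (Fin n) ℝ} {Y : Matrix (Fin c) (Fin n) ℝ}
  {θ : Params c h d}

lemma isGlobalMin_of_productGrad_eq_zero (hG : productGrad F Y θ = 0) :
    IsGlobalMin (loss F Y) θ := by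
  intro θ'
  have key : θ'.1 * θ'.2 * F - Y
      = (θ.1 * θ.2 * F - Y) + (θ'.1 * θ'.2 - θ.1 * θ.2) * F := by
    rw [Matrix.sub_mul]
    abel
  have hcross := trace_transpose_mul_productGrad F Y θ (θ'.1 * θ'.2 - θ.1 * θ.2)
  rw [hG, Matrix.mul_zero, trace_zero] at hcross
  rw [loss, loss, key, frobSq_add, hcross]
  linarith [frobSq_nonneg ((θ'.1 * θ'.2 - θ.1 * θ.2) * F)]

lemma IsCriticalPoint.trace_productVar_eq_zero (hcrit : IsCriticalPoint (loss F Y) θ)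
    (v : Params c h d) : ((productVar θ v)ᵀ * productGrad F Y θ).trace = 0 :=
  hcrit.linear_coeff_eq_zero (contDiff_loss F Y) (loss_add_smul F Y θ v)

lemma IsCriticalPoint.isSecondOrderSaddle_of_secondVar_neg
    (hcrit : IsCriticalPoint (loss F Y) θ) {v : Params c h d} (hv : secondVar F Y θ v < 0) :
    IsSecondOrderSaddle (loss F Y) θ :=
  hcrit.isSecondOrderSaddle (contDiff_loss F Y) (loss_add_smul F Y θ v) (by linarith)

lemma secondVar_nonneg_of_isLocalMin (hmin : IsLocalMin (loss F Y) θ) (v : Params c h d) :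
    0 ≤ secondVar F Y θ v := by
  have h1 := (isCriticalPoint_of_isLocalMin (contDiff_loss F Y) hmin).trace_productVar_eq_zero v
  have h2 := nonneg_of_isLocalMin_quartic hmin (v := v) (a₂ := secondVar F Y θ v / 2)
    (a₃ := ((productVar θ v * F)ᵀ * (v.1 * v.2 * F)).trace)
    (a₄ := frobSq (v.1 * v.2 * F) / 2) fun t => by
      rw [loss_add_smul, h1, zero_mul, add_zero]
  linarith

lemma IsCriticalPoint.transpose_mul_productGrad_eq_zero
    (hcrit : IsCriticalPoint (loss F Y) θ) : θ.1ᵀ * productGrad F Y θ = 0 := by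
  -- Test the derivative in the direction of the gradient with respect to `W₁`.
  refine frobSq_eq_zero ?_
  have := hcrit.trace_productVar_eq_zero (0, θ.1ᵀ * productGrad F Y θ)
  simpa [productVar, transpose_mul, frobSq_eq_trace, Matrix.mul_assoc] using this

lemma IsCriticalPoint.productGrad_mul_transpose_eq_zero
    (hcrit : IsCriticalPoint (loss F Y) θ) : productGrad F Y θ * θ.2ᵀ = 0 := by
  refine frobSq_eq_zero ?_
  have := hcrit.trace_productVar_eq_zero (productGrad F Y θ * θ.2ᵀ, 0)
  rw [frobSq_eq_trace, ← Matrix.mul_assoc, trace_mul_comm]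
  simpa [productVar, transpose_mul, Matrix.mul_assoc] using this

lemma exists_add_mul_neg (C : ℝ) {D : ℝ} (hD : D ≠ 0) : ∃ s : ℝ, C + 2 * (s * D) < 0 :=
  ⟨-(C + 1) / (2 * D), by field_simp; linarith⟩

/-- Where the gradient with respect to the product is nonzero, a kernel vector of `W₂` or of `W₁ᵀ`
produces a direction of negative curvature: the rank-one change of one layer that it defines is
invisible at first order, but its size is a free factor of the cross term `⟨A B, G⟩`. -/
lemma exists_secondVar_neg (hG : productGrad F Y θ ≠ 0) {u : Fin h → ℝ} (hu : u ≠ 0)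
    (hker : θ.1 *ᵥ u = 0 ∨ u ᵥ* θ.2 = 0) : ∃ v, secondVar F Y θ v < 0 := by
  obtain ⟨i, j, hij⟩ : ∃ i j, productGrad F Y θ i j ≠ 0 := by
    by_contra! hall
    exact hG (Matrix.ext hall)
  set a : Fin c → ℝ := Pi.single i 1
  set b : Fin d → ℝ := Pi.single j 1
  have hab : a ⬝ᵥ productGrad F Y θ *ᵥ b = productGrad F Y θ i j := by simp [a, b]
  have hD : (u ⬝ᵥ u) * productGrad F Y θ i j ≠ 0 :=
    mul_ne_zero (fun h0 => hu (dotProduct_self_eq_zero.1 h0)) hij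
  have htr : ∀ s : ℝ, ((s • (vecMulVec a u * vecMulVec u b))ᵀ * productGrad F Y θ).trace
      = s * ((u ⬝ᵥ u) * productGrad F Y θ i j) := fun s => by
    rw [vecMulVec_mul_vecMulVec, vecMulVec_smul, transpose_smul, transpose_smul, Matrix.smul_mul,
      Matrix.smul_mul, trace_smul, trace_smul, trace_transpose_vecMulVec_mul, hab, smul_eq_mul,
      smul_eq_mul]
  rcases hker with hker | hker
  · obtain ⟨s, hs⟩ := exists_add_mul_neg (frobSq (vecMulVec a u * θ.2 * F)) hD
    refine ⟨(vecMulVec a u, s • vecMulVec u b), ?_⟩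
    rw [← htr] at hs
    simpa [secondVar, productVar, mul_vecMulVec, hker] using hs
  · obtain ⟨s, hs⟩ := exists_add_mul_neg (frobSq (θ.1 * vecMulVec u b * F)) hD
    refine ⟨(s • vecMulVec a u, vecMulVec u b), ?_⟩
    rw [← htr] at hs
    have hpv : productVar θ (s • vecMulVec a u, vecMulVec u b) = θ.1 * vecMulVec u b := by
      have h0 : vecMulVec a u * θ.2 = 0 := by
        rw [vecMulVec_mul, hker]
        ext
        simp [vecMulVec_apply]
      rw [productVar, Matrix.smul_mul, h0, smul_zero, add_zero]
    rwa [secondVar, hpv, Matrix.smul_mul]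

lemma exists_ker_of_rank_lt {V : Matrix (Fin c) (Fin h) ℝ} {W : Matrix (Fin h) (Fin d) ℝ}
    (hr : (V * W).rank < h) : ∃ u, u ≠ 0 ∧ (V *ᵥ u = 0 ∨ u ᵥ* W = 0) := by
  by_contra! hall
  obtain ⟨C, hC, -⟩ := exists_left_inverse V fun x hx => by
    by_contra hx0
    exact (hall x hx0).1 hx
  obtain ⟨D, hD, -⟩ := exists_left_inverse Wᵀ fun x hx => by
    by_contra hx0
    exact (hall x hx0).2 (by rwa [mulVec_transpose] at hx)
  have hD' : W * Dᵀ = 1 := by rw [← transpose_one, ← hD, transpose_mul, transpose_transpose]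
  have h1 : C * (V * W * Dᵀ) = 1 := by
    rw [Matrix.mul_assoc V, hD', Matrix.mul_one, hC]
  have h2 : (C * (V * W * Dᵀ)).rank ≤ (V * W).rank :=
    (rank_mul_le_right _ _).trans (rank_mul_le_left _ _)
  rw [h1, rank_one, Fintype.card_fin] at h2
  omega

/-! ### Local minima -/

/-- A nonnegative Hessian compares the residual `R = D F` with the output `K = W₂ W₁ F`:
`‖x‖² ‖Rᵀ y‖² ≤ ‖y‖² ‖Kᵀ x‖²` for `x = W₂ b`. Infinitesimally the test direction rotates the
output direction `x` towards `y` and feeds `Dᵀ y` into the hidden direction `b`. -/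
lemma dotProduct_le_of_secondVar_nonneg (hsec : ∀ v, 0 ≤ secondVar F Y θ v)
    {D : Matrix (Fin c) (Fin d) ℝ} (hG : productGrad F Y θ = -(D * F * Fᵀ))
    (hDW : D * F * (θ.2 * F)ᵀ = 0) (b : Fin h → ℝ) (y : Fin c → ℝ) :
    (θ.1 *ᵥ b ⬝ᵥ θ.1 *ᵥ b) * ((D * F)ᵀ *ᵥ y ⬝ᵥ (D * F)ᵀ *ᵥ y)
      ≤ (y ⬝ᵥ y) * ((θ.1 * (θ.2 * F))ᵀ *ᵥ (θ.1 *ᵥ b) ⬝ᵥ (θ.1 * (θ.2 * F))ᵀ *ᵥ (θ.1 *ᵥ b)) := by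
  set x := θ.1 *ᵥ b with hx
  set r := (D * F)ᵀ *ᵥ y with hr
  set k := (θ.1 * (θ.2 * F))ᵀ *ᵥ x with hk
  clear_value x r k
  have hsec' := hsec (vecMulVec y (θ.1ᵀ *ᵥ x), vecMulVec b (Dᵀ *ᵥ y))
  have hrF : (Dᵀ *ᵥ y) ᵥ* F = r := by
    rw [hr, transpose_mul, ← mulVec_mulVec, mulVec_transpose F]
  have hkF : (θ.1ᵀ *ᵥ x) ᵥ* θ.2 ᵥ* F = k := by
    rw [hk, transpose_mul, ← mulVec_mulVec, mulVec_transpose (θ.2 * F), vecMul_vecMul]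
  have hrk : r ⬝ᵥ k = 0 := by
    rw [hr, hk, transpose_mul θ.1, ← mulVec_mulVec, mulVec_transpose (D * F), ← dotProduct_mulVec,
      mulVec_mulVec, hDW, zero_mulVec, dotProduct_zero]
  have hpv : productVar θ (vecMulVec y (θ.1ᵀ *ᵥ x), vecMulVec b (Dᵀ *ᵥ y)) * F
      = vecMulVec x r + vecMulVec y k := by
    simp only [productVar, Matrix.add_mul, mul_vecMulVec, vecMulVec_mul, hrF, hkF, ← hx]
  have hcross : ((vecMulVec x r)ᵀ * vecMulVec y k).trace = 0 := by
    rw [trace_transpose_vecMulVec_mul, vecMulVec_mulVec, dotProduct_comm k r, hrk]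
    simp
  have hxb : (θ.1ᵀ *ᵥ x) ⬝ᵥ b = x ⬝ᵥ x := by
    rw [mulVec_transpose, ← dotProduct_mulVec, ← hx]
  have hcurv : ((vecMulVec y (θ.1ᵀ *ᵥ x) * vecMulVec b (Dᵀ *ᵥ y))ᵀ * productGrad F Y θ).trace
      = -((x ⬝ᵥ x) * (r ⬝ᵥ r)) := by
    rw [vecMulVec_mul_vecMulVec, vecMulVec_smul, transpose_smul, Matrix.smul_mul, trace_smul,
      trace_transpose_vecMulVec_mul, hxb, hG, neg_mulVec, dotProduct_neg, ← mulVec_mulVec,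
      dotProduct_mulVec, ← mulVec_transpose (D * F), ← hr, mulVec_transpose F, hrF, smul_eq_mul,
      mul_neg]
  rw [secondVar, hpv, frobSq_add, hcross, hcurv, frobSq_vecMulVec, frobSq_vecMulVec] at hsec'
  linarith

/-- If `F` has full row rank, then `F Fᵀ` is invertible and the least-squares problem
`W F ≈ Y` has a solution `W₀`, characterised by the normal equations. -/
lemma exists_least_squares (hF : F.rank = d) (Y : Matrix (Fin c) (Fin n) ℝ) :
    IsUnit (F * Fᵀ) ∧ ∃ W₀ : Matrix (Fin c) (Fin d) ℝ, W₀ * F * Fᵀ = Y * Fᵀ := by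
  have hu : IsUnit (F * Fᵀ) := by
    rw [← mulVec_surjective_iff_isUnit, ← coe_mulVecLin, ← LinearMap.range_eq_top]
    refine Submodule.eq_top_of_finrank_eq ?_
    have := rank_self_mul_transpose F
    rw [hF] at this
    simpa [Matrix.rank] using this
  refine ⟨hu, Y * Fᵀ * (F * Fᵀ)⁻¹, ?_⟩
  rw [Matrix.mul_assoc, Matrix.mul_assoc, nonsing_inv_mul _ ((isUnit_iff_isUnit_det _).1 hu),
    Matrix.mul_one]

lemma isGlobalMin_of_isLocalMin (hF : F.rank = d) (hmin : IsLocalMin (loss F Y) θ) :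
    IsGlobalMin (loss F Y) θ := by
  rcases isEmpty_or_nonempty (Fin h) with hh | hh
  · -- Without hidden units the loss is constant.
    intro θ'
    have e : θ'.1 * θ'.2 = θ.1 * θ.2 := by
      ext i j
      simp [Matrix.mul_apply]
    rw [loss, loss, e]
  have hcrit := isCriticalPoint_of_isLocalMin (contDiff_loss F Y) hmin
  have hsec := secondVar_nonneg_of_isLocalMin hmin
  by_cases hV : ∀ x, θ.1 *ᵥ x = 0 → x = 0
  swap
  · push Not at hV
    obtain ⟨u, hu, hu0⟩ := hV
    refine isGlobalMin_of_productGrad_eq_zero ?_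
    by_contra hG
    obtain ⟨v, hv⟩ := exists_secondVar_neg hG hu0 (.inl hu)
    exact absurd (hsec v) hv.not_ge
  obtain ⟨hu, W₀, hW₀⟩ := exists_least_squares hF Y
  set D := W₀ - θ.1 * θ.2 with hD
  have hG : productGrad F Y θ = -(D * F * Fᵀ) := by
    rw [productGrad, Matrix.sub_mul, ← hW₀, hD, Matrix.sub_mul, Matrix.sub_mul, neg_sub]
  have hDW : D * F * (θ.2 * F)ᵀ = 0 := by
    have := hcrit.productGrad_mul_transpose_eq_zero
    rwa [hG, Matrix.neg_mul, neg_eq_zero, Matrix.mul_assoc, ← transpose_mul] at this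
  have hVD : θ.1ᵀ * (D * F) = 0 := by
    have := hcrit.transpose_mul_productGrad_eq_zero
    rw [hG, Matrix.mul_neg, neg_eq_zero, Matrix.mul_assoc, ← Matrix.mul_assoc] at this
    have h0 : θ.1ᵀ * D = 0 := by
      rw [← Matrix.mul_one (θ.1ᵀ * D), ← mul_nonsing_inv _ ((isUnit_iff_isUnit_det _).1 hu),
        ← Matrix.mul_assoc, this, Matrix.zero_mul]
    rw [← Matrix.mul_assoc, h0, Matrix.zero_mul]
  have hray := dotProduct_le_of_secondVar_nonneg hsec hG hDW
  -- Pythagoras: up to a constant the loss is the squared distance to `W₀ F = W₂ W₁ F + D F`.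
  have hloss : ∀ θ' : Params c h d, loss F Y θ'
      = 1 / 2 * frobSq (θ'.1 * (θ'.2 * F) - (θ.1 * (θ.2 * F) + D * F))
        + 1 / 2 * frobSq (W₀ * F - Y) := fun θ' => by
    have e : θ'.1 * θ'.2 * F - Y = (W₀ * F - Y) + (θ'.1 * θ'.2 - W₀) * F := by
      rw [Matrix.sub_mul]; abel
    have e' : θ'.1 * (θ'.2 * F) - (θ.1 * (θ.2 * F) + D * F) = (θ'.1 * θ'.2 - W₀) * F := by
      simp only [hD, Matrix.sub_mul, Matrix.mul_assoc]; abel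
    have e'' : ((W₀ * F - Y)ᵀ * ((θ'.1 * θ'.2 - W₀) * F)).trace = 0 := by
      rw [← Matrix.mul_assoc, trace_mul_comm, ← Matrix.mul_assoc, ← trace_transpose]
      have : (W₀ * F - Y) * Fᵀ = 0 := by rw [Matrix.sub_mul, hW₀, sub_self]
      rw [transpose_mul, transpose_mul, transpose_transpose, this, Matrix.mul_zero, trace_zero]
    rw [loss, e, e', frobSq_add, e'']
    ring
  obtain ⟨s, hs, hle, hge⟩ := exists_separating_scalar hV hray
  intro θ'
  have h1 := hloss θ
  rw [sub_add_cancel_left, frobSq_neg] at h1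
  rw [h1, hloss θ']
  linarith [frobSq_le_of_separated hV hVD hDW hs hle hge θ'.1 (θ'.2 * F)]
end Net

end LinearNet

end

theorem theorem2 {c h d n : ℕ} (F : Matrix (Fin d) (Fin n) ℝ) (Y : Matrix (Fin c) (Fin n) ℝ)
    (hF : F.rank = d) :
    (∀ θ : LinearNet.Params c h d,
      IsLocalMin (LinearNet.loss F Y) θ → LinearNet.IsGlobalMin (LinearNet.loss F Y) θ) ∧
    (∀ θ : LinearNet.Params c h d,
      LinearNet.IsCriticalPoint (LinearNet.loss F Y) θ → LinearNet.IsDegenerate θ →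
        LinearNet.IsGlobalMin (LinearNet.loss F Y) θ ∨
          LinearNet.IsSecondOrderSaddle (LinearNet.loss F Y) θ) := by
  refine ⟨fun θ hmin => LinearNet.isGlobalMin_of_isLocalMin hF hmin, fun θ hcrit hdeg => ?_⟩
  by_cases hG : LinearNet.productGrad F Y θ = 0
  · exact .inl (LinearNet.isGlobalMin_of_productGrad_eq_zero hG)
  · obtain ⟨u, hu, hker⟩ := LinearNet.exists_ker_of_rank_lt
      (lt_of_lt_of_le hdeg ((min_le_right _ _).trans (min_le_left _ _)))
    obtain ⟨v, hv⟩ := LinearNet.exists_secondVar_neg hG hu hker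
    exact .inr (hcrit.isSecondOrderSaddle_of_secondVar_neg hv)
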